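/- Let $(X_1,Y_1),(X_2,Y_2),\dots$ be i.i.d. with law $H$ on $\mathbb R^2$ having continuous marginal distribution functions $F,G$. For a random variable $Z$ its quantile of order $p\in(0,1)$ is $\inf\{x: P(Z\le x)\ge p\}$; write $F^{-1},G^{-1}$ for the quantile functions and $C(u,v)=H(F^{-1}(u),G^{-1}(v))$ for the copula. Let $R_i,S_i$ be the ranks of $X_i$ among $X_1,\dots,X_n$ and of $Y_i$ among $Y_1,\dots,Y_n$, and for $(u,v)\in(0,1)^2$ put $$C_n(u,v)=\frac1n\sum_{i=1}^n \mathbf 1\Big(\frac{R_i}{n}\le u,\ \frac{S_i}{n}\le v\Big),\qquad q_n(u,v)=\frac{C_n(u,v)-uv}{\sqrt{uv(1-u)(1-v)}} .$$ The null hypothesis $H_0$ is that $X_1,Y_1$ are independent, i.e. $H=F\otimes G$. Fix a law satisfying $H_0$, and for a local level $\eta\in(0,1]$ let the critical surfaces $l_{n,\eta}(u,v)$ and $u_{n,\eta}(u,v)$ be the quantiles of orders $\eta/2$ and $1-\eta/2$ of $q_n(u,v)$ under this law. For $T\subseteq(0,1)^2$ the critical-surface test on $T$ rejects $H_0$ if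 $q_n(u,v)<l_{n,\eta}(u,v)$ or $q_n(u,v)>u_{n,\eta}(u,v)$ for some $(u,v)\in T$. For $\alpha\in(0,1)$ let $\eta_n(\alpha)$ be the supremum of those $\eta\in(0,1]$ for which, under the fixed null law, the test on $(0,1)^2$ rejects with probability at most $\alpha$. Theorem. Let $\alpha\in(0,1)$. (1) Under $H_0$, for every $(u,v)\in(0,1)^2$ the quantiles of orders $\alpha/n^2$ and $1-\alpha/n^2$ of $C_n(u,v)-uv$ tend to $0$ as $n\to\infty$. For every sequence of local levels with $\alpha/n^2\le\eta_n\le1$ for all large $n$, both critical surfaces $l_{n,\eta_n}(u,v)$ and $u_{n,\eta_n}(u,v)$ tend to $0$ for every $(u,v)\in(0,1)^2$. (2) For every $n\ge1$, with local level $\alpha/n^2$ the test on $(0,1)^2$ rejects with probability at most $\alpha$ under every law satisfying $H_0$; and $\alpha/n^2\le\eta_n(\alpha)\le1$. (3) Let $H$ be any fixed law with continuous marginals under which $X_1,Y_1$ are dependent. Then $C_n(u,v)-uv\to C(u,v)-uv$ in probability for every $(u,v)\in(0,1)^2$, and there are $(u_0,v_0)\in(0,1)^2$, $\varepsilon>0$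 and $a>0$ such that the ball $B((u_0,v_0),\varepsilon)$ lies in $(0,1)^2$ and $|C(u,v)-uv|\ge a$ on it. (4) (Consistency.) Under any $H$ as in (3), for every sequence with $\alpha/n^2\le\eta_n\le1$ for all large $n$ (in particular $\eta_n=\alpha/n^2$ or $\eta_n=\eta_n(\alpha)$), and for every sequence of sets $T_n\subseteq(0,1)^2$ such that every ball centred in $(0,1)^2$ meets $T_n$ for all large $n$ (for example $T_n=(0,1)^2$, or $T_n=\{i/n:1\le i\le n-1\}^2$), the probability that the critical-surface test on $T_n$ with local level $\eta_n$ rejects tends to $1$ as $n\to\infty$. -/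

import Mathlib

open MeasureTheory Filter Topology

noncomputable section

namespace CriticalSurface

/-- The quantile of order `p` of the random variable `X` under `P`:
`inf {x : P(X ≤ x) ≥ p}`. -/
def quantile {Ω : Type*} [MeasurableSpace Ω] (P : Measure Ω) (X : Ω → ℝ) (p : ℝ) : ℝ :=
  sInf {x : ℝ | p ≤ P.real {ω | X ω ≤ x}}

/-- The bivariate law `H` has continuous marginal distribution functions. -/
def HasContinuousMarginals (H : Measure (ℝ × ℝ)) : Prop :=
  Continuous (fun x => ProbabilityTheory.cdf H.fst x) ∧
    Continuous (fun y => ProbabilityTheory.cdf H.snd y)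

/-- Under `H` the two coordinates are independent. -/
def IsIndependentLaw (H : Measure (ℝ × ℝ)) : Prop :=
  H = H.fst.prod H.snd

/-- The null hypothesis: continuous marginals and independent coordinates. -/
def NullLaw (H : Measure (ℝ × ℝ)) : Prop :=
  HasContinuousMarginals H ∧ IsIndependentLaw H

/-- A fixed alternative: continuous marginals and dependent coordinates. -/
def AlternativeLaw (H : Measure (ℝ × ℝ)) : Prop :=
  HasContinuousMarginals H ∧ ¬ IsIndependentLaw H

/-- The copula `C(u,v) = H(F⁻¹(u), G⁻¹(v))` of `H`, with `F`, `G` the marginal distributions. -/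
def copula (H : Measure (ℝ × ℝ)) (u v : ℝ) : ℝ :=
  H.real {z | z.1 ≤ quantile H Prod.fst u ∧ z.2 ≤ quantile H Prod.snd v}

/-- The law of an infinite i.i.d. sequence `(X₀,Y₀), (X₁,Y₁), …` with common law `H`. -/
def iidLaw (H : Measure (ℝ × ℝ)) [IsProbabilityMeasure H] : Measure (ℕ → ℝ × ℝ) :=
  Measure.infinitePi (fun _ : ℕ => H)

/-- The rank of `x i` among `x 0, …, x (n-1)`. -/
def rank (x : ℕ → ℝ) (n i : ℕ) : ℕ :=
  ((Finset.range n).filter (fun j => x j ≤ x i)).card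

/-- The plug-in copula estimator from the first `n` observations,
`C_n(u,v) = (1/n) #{i : R_i/n ≤ u, S_i/n ≤ v}`. -/
def empCopula (z : ℕ → ℝ × ℝ) (n : ℕ) (u v : ℝ) : ℝ :=
  (((Finset.range n).filter (fun i =>
    (rank (fun j => (z j).1) n i : ℝ) / n ≤ u ∧
      (rank (fun j => (z j).2) n i : ℝ) / n ≤ v)).card : ℝ) / n

/-- The estimator `q_n` of the quantile dependence function. -/
def qn (z : ℕ → ℝ × ℝ) (n : ℕ) (u v : ℝ) : ℝ :=
  (empCopula z n u v - u * v) / Real.sqrt (u * v * (1 - u) * (1 - v))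

/-- The lower critical surface at local level `η`: the quantile of order `η/2` of `q_n(u,v)`
when the observations have law `H₀`. -/
def lowerSurface (H₀ : Measure (ℝ × ℝ)) [IsProbabilityMeasure H₀] (n : ℕ) (η u v : ℝ) : ℝ :=
  quantile (iidLaw H₀) (fun z => qn z n u v) (η / 2)

/-- The upper critical surface at local level `η`: the quantile of order `1 - η/2`. -/
def upperSurface (H₀ : Measure (ℝ × ℝ)) [IsProbabilityMeasure H₀] (n : ℕ) (η u v : ℝ) : ℝ :=
  quantile (iidLaw H₀) (fun z => qn z n u v) (1 - η / 2)

/-- The open unit square `(0,1)²`. -/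
def openSquare : Set (ℝ × ℝ) := Set.Ioo (0 : ℝ) 1 ×ˢ Set.Ioo (0 : ℝ) 1

/-- The samples for which the test rejects: `q_n` crosses one of the critical surfaces
(computed under `H₀` at local level `η`) at some point of `T`. -/
def rejectionRegion (H₀ : Measure (ℝ × ℝ)) [IsProbabilityMeasure H₀] (n : ℕ) (η : ℝ)
    (T : Set (ℝ × ℝ)) : Set (ℕ → ℝ × ℝ) :=
  {z | ∃ p ∈ T, qn z n p.1 p.2 < lowerSurface H₀ n η p.1 p.2 ∨
    upperSurface H₀ n η p.1 p.2 < qn z n p.1 p.2}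

/-- The local significance level `η_n(α)`: the supremum of the local levels `η` for which the
test on the whole open square has overall significance level at most `α`. -/
def localLevel (H₀ : Measure (ℝ × ℝ)) [IsProbabilityMeasure H₀] (n : ℕ) (α : ℝ) : ℝ :=
  sSup {η : ℝ | 0 < η ∧ η ≤ 1 ∧
    (iidLaw H₀).real (rejectionRegion H₀ n η openSquare) ≤ α}

/-- A sequence of sets of test points in `(0,1)²` that eventually meets every ball centred in
`(0,1)²`: the whole square, or finer and finer grids. -/
def RefiningTestPoints (T : ℕ → Set (ℝ × ℝ)) : Prop :=
  (∀ n, T n ⊆ openSquare) ∧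
    ∀ p ∈ openSquare, ∀ r : ℝ, 0 < r → ∀ᶠ n in atTop, (T n ∩ Metric.ball p r).Nonempty

end CriticalSurface

end

noncomputable section

namespace CriticalSurface

/-! ### Quantiles -/

section Quantile

variable {Ω : Type*} [MeasurableSpace Ω] {P : Measure Ω} [IsProbabilityMeasure P] {X : Ω → ℝ}

/-! The critical surfaces shrink to zero because even the tiny local level `α / n ^ 2` is far larger
than the exponentially small probability that `C_n(u,v)` misses `C(u,v)` by a fixed amount. A
dependent law keeps `C(u,v)` away from `uv` on a whole ball, so any test point in that ball
eventually gives rejection.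

Concentration (`measureReal_empCopula_le`) needs no empirical process theory. Without ties, a
pathwise comparison of rank sets with sets cut at true quantiles (`abs_empCopula_sub_le`) reduces it
to Hoeffding's inequality for three events. The bound does not depend on `(u,v)`; this uniformity
lets the test point in `T n` move with `n`.

The level of the test is a union bound. `C_n` depends on `(u,v)` only through `⌊nu⌋` and `⌊nv⌋`,
hence takes at most `n ^ 2` different forms, and each costs at most `α / n ^ 2`. Since ranks are
invariant under increasing transformations, the law of `C_n(u,v)` is the same under every null law
(`map_empCopula_eq`), so surfaces computed under one null law serve all of them.

For alternatives, `C(u,v) = uv` on the open square would force independence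
(`isIndependentLaw_of_copula`), and the Lipschitz property of copulas spreads a single discrepancy
to a ball. -/

lemma measureReal_le_eq_cdf (hX : Measurable X) (x : ℝ) :
    P.real {ω | X ω ≤ x} = ProbabilityTheory.cdf (P.map X) x := by
  have : IsProbabilityMeasure (P.map X) := Measure.isProbabilityMeasure_map hX.aemeasurable
  rw [ProbabilityTheory.cdf_eq_real, map_measureReal_apply hX measurableSet_Iic]
  rfl

lemma bddBelow_quantile (hX : Measurable X) {p : ℝ} (hp : 0 < p) :
    BddBelow {x : ℝ | p ≤ P.real {ω | X ω ≤ x}} := by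
  obtain ⟨b, hb⟩ := ((ProbabilityTheory.tendsto_cdf_atBot (P.map X)).eventually_lt_const hp).exists
  refine ⟨b, fun x hx => ?_⟩
  by_contra! h
  have h1 := ProbabilityTheory.monotone_cdf (P.map X) h.le
  have h2 : p ≤ P.real {ω | X ω ≤ x} := hx
  rw [measureReal_le_eq_cdf hX] at h2
  linarith

lemma nonempty_quantile (hX : Measurable X) {p : ℝ} (hp : p < 1) :
    {x : ℝ | p ≤ P.real {ω | X ω ≤ x}}.Nonempty := by
  obtain ⟨b, hb⟩ :=
    ((ProbabilityTheory.tendsto_cdf_atTop (P.map X)).eventually_const_lt hp).exists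
  refine ⟨b, ?_⟩
  rw [Set.mem_ofPred_eq, measureReal_le_eq_cdf hX]
  exact hb.le

/-- A two-sided tail bound traps the quantile once the tail is lighter than both `p` and `1 - p`.
Strictness on the `p` side excludes points below `-ε` and also gives `0 < p`, so that the infimum is
over a set bounded below. -/
lemma abs_quantile_le (hX : Measurable X) {p ε : ℝ} (hp : P.real {ω | ε < |X ω|} < p)
    (hp' : P.real {ω | ε < |X ω|} ≤ 1 - p) : |quantile P X p| ≤ ε := by
  have hp0 : 0 < p := measureReal_nonneg.trans_lt hp
  have hmem : ε ∈ {x : ℝ | p ≤ P.real {ω | X ω ≤ x}} := by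
    have h1 : ({ω | X ω ≤ ε})ᶜ ⊆ {ω | ε < |X ω|} := fun ω hω => by
      simp only [Set.mem_compl_iff, Set.mem_ofPred_eq, not_le] at hω ⊢
      exact hω.trans_le (le_abs_self _)
    have h2 := measureReal_mono (μ := P) h1
    rw [probReal_compl_eq_one_sub (measurableSet_le hX measurable_const)] at h2
    simp only [Set.mem_ofPred_eq]
    linarith
  rw [abs_le]
  refine ⟨le_csInf ⟨ε, hmem⟩ fun x hx => ?_, csInf_le (bddBelow_quantile hX hp0) hmem⟩
  by_contra! h
  have h1 : {ω | X ω ≤ x} ⊆ {ω | ε < |X ω|} := fun ω hω => by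
    simp only [Set.mem_ofPred_eq] at hω ⊢
    linarith [neg_abs_le (X ω)]
  have h2 := measureReal_mono (μ := P) h1
  have h3 : p ≤ P.real {ω | X ω ≤ x} := hx
  linarith

lemma measureReal_le_quantile (hX : Measurable X) (hc : Continuous fun x => P.real {ω | X ω ≤ x})
    {p : ℝ} (hp : p ∈ Set.Ioo (0 : ℝ) 1) : P.real {ω | X ω ≤ quantile P X p} = p := by
  have hbdd := bddBelow_quantile (P := P) hX hp.1
  refine le_antisymm ?_ ?_
  · by_contra! h
    obtain ⟨y, hy, hy'⟩ := ((hc.continuousAt.eventually_const_lt h).filter_mono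
      nhdsWithin_le_nhds |>.and (self_mem_nhdsWithin (s := Set.Iio (quantile P X p)))).exists
    exact absurd (csInf_le hbdd (show y ∈ {x : ℝ | p ≤ P.real {ω | X ω ≤ x}} from hy.le))
      (not_le.2 hy')
  · exact (isClosed_le continuous_const hc).csInf_mem (nonempty_quantile hX hp.2) hbdd

lemma quantile_mono (hX : Measurable X) {p q : ℝ} (hp : 0 < p) (hq : q < 1) (hpq : p ≤ q) :
    quantile P X p ≤ quantile P X q :=
  csInf_le_csInf (bddBelow_quantile hX hp) (nonempty_quantile hX hq) fun _ hx => hpq.trans hx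

/-- A random variable with finitely many values rarely falls in its own lower tail. -/
lemma measureReal_tail_le (hfin : (Set.range X).Finite) {p : ℝ} (hp : 0 ≤ p) :
    P.real {ω | P.real {ω' | X ω' ≤ X ω} ≤ p} ≤ p := by
  set A := {ω | P.real {ω' | X ω' ≤ X ω} ≤ p}
  rcases A.eq_empty_or_nonempty with h | h
  · simpa [h] using hp
  · obtain ⟨_, ⟨ω, hω, rfl⟩, hmax⟩ := (hfin.subset (Set.image_subset_range X A)).exists_maximal
      (h.image X)
    have : A ⊆ {ω' | X ω' ≤ X ω} := fun ω' hω' => by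
      by_contra hlt
      simp only [Set.mem_ofPred_eq, not_le] at hlt
      exact absurd (hmax (Set.mem_image_of_mem X hω') hlt.le) (not_le.2 hlt)
    exact (measureReal_mono this).trans hω

end Quantile

/-! ### Ranks -/

section Rank

variable {x : ℕ → ℝ} {n : ℕ}

lemma rank_le_rank {i j : ℕ} (h : x i ≤ x j) : rank x n i ≤ rank x n j := by
  refine Finset.card_le_card fun k hk => ?_
  simp only [Finset.mem_filter] at hk ⊢
  exact ⟨hk.1, hk.2.trans h⟩

lemma rank_lt_rank {i j : ℕ} (hj : j < n) (h : x i < x j) : rank x n i < rank x n j := by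
  refine Finset.card_lt_card ⟨fun k hk => ?_, fun hs => ?_⟩
  · simp only [Finset.mem_filter] at hk ⊢
    exact ⟨hk.1, hk.2.trans h.le⟩
  · have := hs (Finset.mem_filter.2 ⟨Finset.mem_range.2 hj, le_rfl⟩)
    exact absurd (Finset.mem_filter.1 this).2 (not_le.2 h)

lemma rank_injOn (hx : Set.InjOn x (Finset.range n)) :
    Set.InjOn (rank x n) (Finset.range n) := by
  intro i hi j hj hij
  rcases lt_trichotomy (x i) (x j) with h | h | h
  · exact absurd hij (rank_lt_rank (by simpa using hj) h).ne
  · exact hx hi hj h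
  · exact absurd hij (rank_lt_rank (by simpa using hi) h).ne'

lemma image_rank (hx : Set.InjOn x (Finset.range n)) :
    (Finset.range n).image (rank x n) = Finset.Icc 1 n := by
  refine Finset.eq_of_subset_of_card_le (fun k hk => ?_) ?_
  · obtain ⟨i, hi, rfl⟩ := Finset.mem_image.1 hk
    refine Finset.mem_Icc.2 ⟨Finset.card_pos.2 ⟨i, Finset.mem_filter.2 ⟨hi, le_rfl⟩⟩, ?_⟩
    exact (Finset.card_filter_le _ _).trans (Finset.card_range n).le
  · rw [Finset.card_image_of_injOn (rank_injOn hx)]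
    simp

/-- Without ties the ranks are a permutation of `1, …, n`. -/
lemma card_rank_le (hx : Set.InjOn x (Finset.range n)) {k : ℕ} (hk : k ≤ n) :
    ((Finset.range n).filter fun i => rank x n i ≤ k).card = k := by
  rw [← Finset.card_image_of_injOn ((rank_injOn hx).mono (Finset.filter_subset _ _)),
    ← Finset.filter_image (p := fun r => r ≤ k), image_rank hx]
  have : (Finset.Icc 1 n).filter (fun r => r ≤ k) = Finset.Icc 1 k := by
    ext r
    simp only [Finset.mem_filter, Finset.mem_Icc]
    omega
  rw [this, Nat.card_Icc]
  omega

lemma rank_div_le_iff (hn : 1 ≤ n) {u : ℝ} (hu : 0 ≤ u) (i : ℕ) :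
    (rank x n i : ℝ) / n ≤ u ↔ rank x n i ≤ ⌊n * u⌋₊ := by
  have hn' : (0 : ℝ) < n := by exact_mod_cast hn
  rw [div_le_iff₀ hn', Nat.le_floor_iff (by positivity), mul_comm]

lemma abs_card_rank_div_le (hn : 1 ≤ n) (hx : Set.InjOn x (Finset.range n)) {u : ℝ}
    (hu : u ∈ Set.Ioo (0 : ℝ) 1) :
    |(((Finset.range n).filter fun i => (rank x n i : ℝ) / n ≤ u).card : ℝ) / n - u| ≤ 1 / n := by
  have hn' : (0 : ℝ) < n := by exact_mod_cast hn
  simp only [rank_div_le_iff hn hu.1.le]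
  have h0 : 0 ≤ n * u := by have := hu.1; positivity
  have hk : ⌊n * u⌋₊ ≤ n := Nat.floor_le_of_le (by nlinarith [hu.2])
  rw [card_rank_le hx hk, div_sub' hn'.ne', abs_div, abs_of_pos hn']
  refine div_le_div_of_nonneg_right ?_ hn'.le
  rw [abs_le]
  constructor <;> linarith [Nat.lt_floor_add_one (n * u), Nat.floor_le h0]

/-- For nested sets the gap in cardinality splits into its parts inside and outside `C`, both of the
same sign, so neither part exceeds the whole. -/
lemma abs_card_inter_sub_le {ι : Type*} [DecidableEq ι] (A B C : Finset ι) (h : A ⊆ B ∨ B ⊆ A) :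
    |((A ∩ C).card : ℝ) - (B ∩ C).card| ≤ |(A.card : ℝ) - B.card| := by
  have key : ∀ A B : Finset ι, A ⊆ B →
      |((A ∩ C).card : ℝ) - (B ∩ C).card| ≤ |(A.card : ℝ) - B.card| := fun A B h => by
    have h1 : (A ∩ C).card ≤ (B ∩ C).card :=
      Finset.card_le_card (Finset.inter_subset_inter_right h)
    have h2 : A.card ≤ B.card := Finset.card_le_card h
    have h3 := Finset.card_inter_add_card_sdiff A C
    have h4 := Finset.card_inter_add_card_sdiff B C
    have h5 : (A \ C).card ≤ (B \ C).card := Finset.card_le_card (Finset.sdiff_subset_sdiff h le_rfl)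
    rw [abs_sub_comm, abs_sub_comm (A.card : ℝ), abs_of_nonneg, abs_of_nonneg]
    · rw [← h3, ← h4]
      push_cast
      have : ((A \ C).card : ℝ) ≤ (B \ C).card := by exact_mod_cast h5
      linarith
    · rw [sub_nonneg]; exact_mod_cast h2
    · rw [sub_nonneg]; exact_mod_cast h1
  rcases h with h | h
  · exact key A B h
  · rw [abs_sub_comm, abs_sub_comm (A.card : ℝ)]
    exact key B A h

/-- Both sets are initial segments for the order of the observations. -/
lemma rank_segment_total (u s : ℝ) :
    ((Finset.range n).filter fun i => (rank x n i : ℝ) / n ≤ u) ⊆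
        (Finset.range n).filter (fun i => x i ≤ s) ∨
      (Finset.range n).filter (fun i => x i ≤ s) ⊆
        (Finset.range n).filter fun i => (rank x n i : ℝ) / n ≤ u := by
  by_contra! h
  obtain ⟨h1, h2⟩ := h
  obtain ⟨i, hi, hi'⟩ := Finset.not_subset.1 h1
  obtain ⟨j, hj, hj'⟩ := Finset.not_subset.1 h2
  simp only [Finset.mem_filter, not_and] at hi hi' hj hj'
  have hlt : x j ≤ x i := by linarith [not_le.1 (hi' hi.1)]
  refine hj' hj.1 (le_trans ?_ hi.2)
  have : (rank x n j : ℝ) ≤ rank x n i := by exact_mod_cast rank_le_rank hlt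
  gcongr

end Rank

/-- The rank set and the threshold set in each coordinate are nested, so exchanging one for the
other costs only the difference of their cardinalities, and the rank set has `nu` elements up to
one. The bound is deterministic and holds for all `s` and `t`; true quantiles are inserted later. -/
lemma abs_empCopula_sub_le {z : ℕ → ℝ × ℝ} {n : ℕ} (hn : 1 ≤ n)
    (hx : Set.InjOn (fun i => (z i).1) (Finset.range n))
    (hy : Set.InjOn (fun i => (z i).2) (Finset.range n)) {u v : ℝ}
    (hu : u ∈ Set.Ioo (0 : ℝ) 1) (hv : v ∈ Set.Ioo (0 : ℝ) 1) (s t : ℝ) :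
    |empCopula z n u v -
        (((Finset.range n).filter fun i => (z i).1 ≤ s ∧ (z i).2 ≤ t).card : ℝ) / n| ≤
      |(((Finset.range n).filter fun i => (z i).1 ≤ s).card : ℝ) / n - u| +
      |(((Finset.range n).filter fun i => (z i).2 ≤ t).card : ℝ) / n - v| + 2 / n := by
  have hn' : (0 : ℝ) < n := by exact_mod_cast hn
  have h1 := abs_card_rank_div_le hn hx hu
  have h2 := abs_card_rank_div_le hn hy hv
  have h3 := rank_segment_total (x := fun i => (z i).1) (n := n) u s
  have h4 := rank_segment_total (x := fun i => (z i).2) (n := n) v t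
  unfold empCopula
  rw [Finset.filter_and, Finset.filter_and]
  set A := (Finset.range n).filter fun i => (rank (fun j => (z j).1) n i : ℝ) / n ≤ u
  set B := (Finset.range n).filter fun i => (rank (fun j => (z j).2) n i : ℝ) / n ≤ v
  set A' := (Finset.range n).filter fun i => (z i).1 ≤ s
  set B' := (Finset.range n).filter fun i => (z i).2 ≤ t
  have h5 := div_le_div_of_nonneg_right (abs_card_inter_sub_le A A' B h3) hn'.le
  have h6 := div_le_div_of_nonneg_right (abs_card_inter_sub_le B B' A' h4) hn'.le
  have hdiv : ∀ a b : ℝ, |a - b| / n = |a / n - b / n| := fun a b => by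
    rw [← sub_div, abs_div, abs_of_pos hn']
  rw [hdiv, hdiv] at h5 h6
  rw [Finset.inter_comm B A', Finset.inter_comm B' A'] at h6
  have h7 := abs_sub_le ((A ∩ B).card / n : ℝ) ((A' ∩ B).card / n) ((A' ∩ B').card / n)
  have h8 := abs_sub_le (A.card / n : ℝ) u (A'.card / n)
  have h9 := abs_sub_le (B.card / n : ℝ) v (B'.card / n)
  rw [abs_sub_comm u] at h8
  rw [abs_sub_comm v] at h9
  have : (2 : ℝ) / n = 1 / n + 1 / n := by ring
  linarith

/-! ### Measurability and ties -/

lemma measurable_empCopula (n : ℕ) (u v : ℝ) : Measurable fun z => empCopula z n u v := by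
  have hrank : ∀ (g : ℝ × ℝ → ℝ), Measurable g → ∀ i,
      Measurable fun z : ℕ → ℝ × ℝ => (rank (fun j => g (z j)) n i : ℝ) := by
    intro g hg i
    simp only [rank, Finset.card_filter, Nat.cast_sum]
    refine Finset.measurable_sum _ fun j _ => ?_
    simp only [Nat.cast_ite, Nat.cast_one, Nat.cast_zero]
    exact Measurable.ite (measurableSet_le (by fun_prop) (by fun_prop)) measurable_const
      measurable_const
  simp only [empCopula, Finset.card_filter, Nat.cast_sum]
  refine Measurable.div_const (Finset.measurable_sum _ fun i _ => ?_) _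
  simp only [Nat.cast_ite, Nat.cast_one, Nat.cast_zero]
  exact Measurable.ite
    ((measurableSet_le ((hrank _ measurable_fst i).div_const _) measurable_const).inter
      (measurableSet_le ((hrank _ measurable_snd i).div_const _) measurable_const))
    measurable_const measurable_const

lemma measurable_qn (n : ℕ) (u v : ℝ) : Measurable fun z => qn z n u v :=
  ((measurable_empCopula n u v).sub_const _).div_const _

instance (H : Measure (ℝ × ℝ)) [IsProbabilityMeasure H] : IsProbabilityMeasure (iidLaw H) := by
  unfold iidLaw; infer_instance

lemma nullSingletonClass_of_continuous_cdf (μ : Measure ℝ) [IsProbabilityMeasure μ]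
    (h : Continuous fun x => ProbabilityTheory.cdf μ x) : NullSingletonClass μ := by
  refine ⟨fun a => ?_⟩
  rw [← ProbabilityTheory.measure_cdf μ, StieltjesFunction.measure_singleton,
    h.continuousAt.continuousWithinAt.leftLim_eq]
  simp

/-- Two distinct coordinates of the sequence have law `H.prod H`; by Fubini the diagonal event is
null because its fibres are preimages of single points. -/
lemma ae_injOn {H : Measure (ℝ × ℝ)} [IsProbabilityMeasure H] {g : ℝ × ℝ → ℝ} (hg : Measurable g)
    [NullSingletonClass (H.map g)] (n : ℕ) :
    ∀ᵐ z ∂(iidLaw H), Set.InjOn (fun i => g (z i)) (Finset.range n) := by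
  have key : ∀ i j : ℕ, i ≠ j → ∀ᵐ z ∂(iidLaw H), g (z i) ≠ g (z j) := by
    intro i j hij
    have h1 : ∀ᵐ w ∂(H.prod H), g w.1 ≠ g w.2 := by
      have hm : MeasurableSet {w : (ℝ × ℝ) × (ℝ × ℝ) | g w.1 = g w.2} :=
        measurableSet_eq_fun (by fun_prop) (by fun_prop)
      rw [ae_iff]
      simp only [ne_eq, not_not]
      rw [Measure.measure_prod_null hm]
      refine ae_of_all _ fun a => ?_
      have h2 := measure_singleton (μ := H.map g) (g a)
      rw [Measure.map_apply hg (measurableSet_singleton _)] at h2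
      simpa [Set.preimage, eq_comm] using h2
    rw [← Measure.infinitePi_map_eval_prod (P := fun _ : ℕ => H) hij] at h1
    have h3 : Measurable fun z : ℕ → ℝ × ℝ => (z i, z j) := by fun_prop
    exact ae_of_ae_map (p := fun w => g w.1 ≠ g w.2) h3.aemeasurable h1
  have h2 : ∀ᵐ z ∂(iidLaw H), ∀ i j : ℕ, i ≠ j → g (z i) ≠ g (z j) := by
    simp only [ae_all_iff]
    exact fun i j hij => key i j hij
  filter_upwards [h2] with z hz i _ j _ hij
  by_contra hne
  exact hz i j hne hij

/-! ### Concentration of the empirical copula -/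

/-- Hoeffding's inequality for indicators, applied to both signs. The variance proxy `1 / 4` is the
squared half-length of `[0, 1]`. -/
lemma measureReal_empirical_le {H : Measure (ℝ × ℝ)} [IsProbabilityMeasure H] {A : Set (ℝ × ℝ)}
    (hA : MeasurableSet A) [DecidablePred (· ∈ A)] {n : ℕ} (hn : 1 ≤ n) {ε : ℝ} (hε : 0 ≤ ε) :
    (iidLaw H).real {z | ε ≤ |(((Finset.range n).filter fun i => z i ∈ A).card : ℝ) / n
      - H.real A|} ≤ 2 * Real.exp (-2 * n * ε ^ 2) := by
  have hn' : (0 : ℝ) < n := by exact_mod_cast hn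
  set f : ℝ × ℝ → ℝ := A.indicator 1 with hf
  have hfm : Measurable f := measurable_one.indicator hA
  have hsub : ProbabilityTheory.HasSubgaussianMGF (fun w => f w - H.real A) (1 / 4) H := by
    have h := ProbabilityTheory.hasSubgaussianMGF_of_mem_Icc (μ := H) (X := f) (a := 0) (b := 1)
      hfm.aemeasurable (ae_of_all _ fun w => by
        by_cases hw : w ∈ A <;> simp [hf, hw])
    have h1 : ∫ w, f w ∂H = H.real A := integral_indicator_one hA
    rw [h1] at h
    convert h using 1
    ext
    norm_num
  have hiid : ∀ i : ℕ, ProbabilityTheory.HasSubgaussianMGF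
      (fun z : ℕ → ℝ × ℝ => f (z i) - H.real A) (1 / 4) (iidLaw H) := by
    intro i
    refine ProbabilityTheory.HasSubgaussianMGF.of_map (Y := fun z : ℕ → ℝ × ℝ => z i)
      (X := fun w => f w - H.real A) (measurable_pi_apply i).aemeasurable ?_
    rw [iidLaw, Measure.infinitePi_map_eval]
    exact hsub
  have hind : ProbabilityTheory.iIndepFun
      (fun (i : ℕ) (z : ℕ → ℝ × ℝ) => f (z i) - H.real A) (iidLaw H) :=
    ProbabilityTheory.iIndepFun_infinitePi (X := fun _ w => f w - H.real A) (by fun_prop)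
  have hind' : ProbabilityTheory.iIndepFun
      (fun (i : ℕ) (z : ℕ → ℝ × ℝ) => -(f (z i) - H.real A)) (iidLaw H) :=
    ProbabilityTheory.iIndepFun_infinitePi (X := fun _ w => -(f w - H.real A)) (by fun_prop)
  have hexp : -(n * ε) ^ 2 / (2 * n * ((1 / 4 : NNReal) : ℝ)) = -2 * n * ε ^ 2 := by
    push_cast
    field_simp
    ring
  have h1 := ProbabilityTheory.HasSubgaussianMGF.measure_sum_range_ge_le_of_iIndepFun hind
    (n := n) (fun i _ => hiid i) (ε := n * ε) (by positivity)
  have h2 := ProbabilityTheory.HasSubgaussianMGF.measure_sum_range_ge_le_of_iIndepFun hind'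
    (n := n) (fun i _ => (hiid i).neg) (ε := n * ε) (by positivity)
  rw [hexp] at h1 h2
  rw [two_mul]
  refine le_trans (le_trans (measureReal_mono ?_) (measureReal_union_le _ _)) (add_le_add h1 h2)
  intro z hz
  simp only [Set.mem_ofPred_eq, Set.mem_union] at hz ⊢
  have hcard : (((Finset.range n).filter fun i => z i ∈ A).card : ℝ)
      = ∑ i ∈ Finset.range n, f (z i) := by
    rw [Finset.card_filter]
    push_cast
    refine Finset.sum_congr rfl fun i _ => ?_
    by_cases hw : z i ∈ A <;> simp [hf, hw]
  rw [Finset.sum_neg_distrib, Finset.sum_sub_distrib, ← hcard, Finset.sum_const, Finset.card_range,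
    nsmul_eq_mul]
  rw [div_sub' hn'.ne', abs_div, abs_of_pos hn', le_div_iff₀ hn', mul_comm, le_abs] at hz
  exact hz

section Marginals

variable {H : Measure (ℝ × ℝ)} [IsProbabilityMeasure H]

lemma cdf_fst_eq (x : ℝ) : ProbabilityTheory.cdf H.fst x = H.real {z | z.1 ≤ x} :=
  (measureReal_le_eq_cdf measurable_fst x).symm

lemma cdf_snd_eq (x : ℝ) : ProbabilityTheory.cdf H.snd x = H.real {z | z.2 ≤ x} :=
  (measureReal_le_eq_cdf measurable_snd x).symm

lemma HasContinuousMarginals.continuous_fst (hH : HasContinuousMarginals H) :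
    Continuous fun x => H.real {z | z.1 ≤ x} := by
  simpa only [cdf_fst_eq] using hH.1

lemma HasContinuousMarginals.continuous_snd (hH : HasContinuousMarginals H) :
    Continuous fun x => H.real {z | z.2 ≤ x} := by
  simpa only [cdf_snd_eq] using hH.2

lemma measureReal_fst_le_quantile (hH : HasContinuousMarginals H) {u : ℝ}
    (hu : u ∈ Set.Ioo (0 : ℝ) 1) : H.real {z | z.1 ≤ quantile H Prod.fst u} = u :=
  measureReal_le_quantile measurable_fst hH.continuous_fst hu

lemma measureReal_snd_le_quantile (hH : HasContinuousMarginals H) {u : ℝ}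
    (hu : u ∈ Set.Ioo (0 : ℝ) 1) : H.real {z | z.2 ≤ quantile H Prod.snd u} = u :=
  measureReal_le_quantile measurable_snd hH.continuous_snd hu

/-- Outside three Hoeffding events (two half-planes and their quadrant), the pathwise comparison
contributes `ε + ε + 2 / n ≤ 3ε` and the quadrant frequency one more `ε`. -/
lemma measureReal_empCopula_le (hH : HasContinuousMarginals H) {n : ℕ} (hn : 1 ≤ n) {ε : ℝ}
    (hε : 0 < ε) (hnε : 2 / (n : ℝ) ≤ ε) {u v : ℝ}
    (hu : u ∈ Set.Ioo (0 : ℝ) 1) (hv : v ∈ Set.Ioo (0 : ℝ) 1) :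
    (iidLaw H).real {z | 4 * ε < |empCopula z n u v - copula H u v|} ≤
      6 * Real.exp (-2 * n * ε ^ 2) := by
  classical
  have : NullSingletonClass (H.map Prod.fst) := nullSingletonClass_of_continuous_cdf H.fst hH.1
  have : NullSingletonClass (H.map Prod.snd) := nullSingletonClass_of_continuous_cdf H.snd hH.2
  set s := quantile H Prod.fst u with hs
  set t := quantile H Prod.snd v with ht
  have hms : MeasurableSet {w : ℝ × ℝ | w.1 ≤ s} := measurableSet_le measurable_fst measurable_const
  have hmt : MeasurableSet {w : ℝ × ℝ | w.2 ≤ t} := measurableSet_le measurable_snd measurable_const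
  have h1 := measureReal_empirical_le (H := H) hms hn hε.le
  have h2 := measureReal_empirical_le (H := H) hmt hn hε.le
  have h3 := measureReal_empirical_le (H := H) (A := {w : ℝ × ℝ | w.1 ≤ s ∧ w.2 ≤ t})
    (hms.inter hmt) hn hε.le
  rw [measureReal_fst_le_quantile hH hu] at h1
  rw [measureReal_snd_le_quantile hH hv] at h2
  set E1 := {z : ℕ → ℝ × ℝ | ε ≤ |(((Finset.range n).filter fun i =>
    z i ∈ {w : ℝ × ℝ | w.1 ≤ s}).card : ℝ) / n - u|}
  set E2 := {z : ℕ → ℝ × ℝ | ε ≤ |(((Finset.range n).filter fun i =>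
    z i ∈ {w : ℝ × ℝ | w.2 ≤ t}).card : ℝ) / n - v|}
  set E3 := {z : ℕ → ℝ × ℝ | ε ≤ |(((Finset.range n).filter fun i =>
    z i ∈ {w : ℝ × ℝ | w.1 ≤ s ∧ w.2 ≤ t}).card : ℝ) / n
      - H.real {w : ℝ × ℝ | w.1 ≤ s ∧ w.2 ≤ t}|}
  have hsub : {z | 4 * ε < |empCopula z n u v - copula H u v|} ≤ᵐ[iidLaw H]
      (E1 ∪ (E2 ∪ E3) : Set (ℕ → ℝ × ℝ)) := by
    filter_upwards [ae_injOn (H := H) measurable_fst n, ae_injOn (H := H) measurable_snd n]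
      with z hx hy hz
    by_contra hcon
    have hz' : 4 * ε < |empCopula z n u v - copula H u v| := hz
    have hcon' : z ∉ E1 ∪ (E2 ∪ E3) := hcon
    simp only [E1, E2, E3, Set.mem_union, not_or, Set.mem_ofPred_eq, not_le] at hcon'
    obtain ⟨c1, c2, c3⟩ := hcon'
    have h4 := abs_empCopula_sub_le hn hx hy hu hv s t
    have h5 := abs_sub_le (empCopula z n u v)
      ((((Finset.range n).filter fun i => (z i).1 ≤ s ∧ (z i).2 ≤ t).card : ℝ) / n)
      (copula H u v)
    have h6 : copula H u v = H.real {w : ℝ × ℝ | w.1 ≤ s ∧ w.2 ≤ t} := rfl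
    rw [← h6] at c3
    linarith
  have h7 := measureReal_union_le (μ := iidLaw H) E1 (E2 ∪ E3)
  have h8 := measureReal_union_le (μ := iidLaw H) E2 E3
  have h9 : (iidLaw H).real {z | 4 * ε < |empCopula z n u v - copula H u v|} ≤
      (iidLaw H).real (E1 ∪ (E2 ∪ E3)) :=
    ENNReal.toReal_mono (measure_ne_top _ _) (measure_mono_ae hsub)
  linarith

/-- Uniform concentration of the empirical copula, faster than `n⁻²`. -/
lemma eventually_measureReal_empCopula_lt (hH : HasContinuousMarginals H) {ε δ : ℝ}
    (hε : 0 < ε) (hδ : 0 < δ) : ∀ᶠ n : ℕ in atTop, ∀ u ∈ Set.Ioo (0 : ℝ) 1,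
      ∀ v ∈ Set.Ioo (0 : ℝ) 1,
        (iidLaw H).real {z | ε < |empCopula z n u v - copula H u v|} < δ / (n : ℝ) ^ 2 := by
  have hlim : Tendsto (fun n : ℕ => (n : ℝ) ^ 2 * Real.exp (-(2 * (ε / 4) ^ 2) * n)) atTop
      (𝓝 0) := by
    have h := (tendsto_rpow_mul_exp_neg_mul_atTop_nhds_zero 2 (2 * (ε / 4) ^ 2)
      (by positivity)).comp tendsto_natCast_atTop_atTop
    simpa [Function.comp_def] using h
  have h2 : Tendsto (fun n : ℕ => 2 / (n : ℝ)) atTop (𝓝 0) :=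
    tendsto_const_div_atTop_nhds_zero_nat 2
  filter_upwards [hlim.eventually_lt_const (show (0 : ℝ) < δ / 6 by positivity),
    h2.eventually_le_const (show (0 : ℝ) < ε / 4 by positivity), eventually_ge_atTop 1]
    with n h3 h4 hn u hu v hv
  have hn' : (0 : ℝ) < n := by exact_mod_cast hn
  have h5 := measureReal_empCopula_le hH hn (by positivity) h4 hu hv
  rw [mul_div_cancel₀ _ (by norm_num : (4 : ℝ) ≠ 0)] at h5
  refine h5.trans_lt ?_
  rw [lt_div_iff₀ (by positivity)]
  rw [show -2 * (n : ℝ) * (ε / 4) ^ 2 = -(2 * (ε / 4) ^ 2) * n by ring]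
  nlinarith

end Marginals

/-! ### The copula -/

section Copula

variable {H : Measure (ℝ × ℝ)} [IsProbabilityMeasure H]

lemma copula_of_null (hH : NullLaw H) {u v : ℝ} (hu : u ∈ Set.Ioo (0 : ℝ) 1)
    (hv : v ∈ Set.Ioo (0 : ℝ) 1) : copula H u v = u * v := by
  have h1 := measureReal_fst_le_quantile hH.1 hu
  have h2 := measureReal_snd_le_quantile hH.1 hv
  rw [← cdf_fst_eq, ProbabilityTheory.cdf_eq_real] at h1
  rw [← cdf_snd_eq, ProbabilityTheory.cdf_eq_real] at h2
  have h3 : {z : ℝ × ℝ | z.1 ≤ quantile H Prod.fst u ∧ z.2 ≤ quantile H Prod.snd v} =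
      Set.Iic (quantile H Prod.fst u) ×ˢ Set.Iic (quantile H Prod.snd v) := rfl
  have h4 : copula H u v = (H.fst.prod H.snd).real
      (Set.Iic (quantile H Prod.fst u) ×ˢ Set.Iic (quantile H Prod.snd v)) := by
    rw [← hH.2, ← h3]; rfl
  rw [h4, measureReal_prod_prod, h1, h2]

lemma measurableSet_fst_le (s : ℝ) : MeasurableSet {z : ℝ × ℝ | z.1 ≤ s} :=
  measurableSet_le measurable_fst measurable_const

lemma measurableSet_snd_le (s : ℝ) : MeasurableSet {z : ℝ × ℝ | z.2 ≤ s} :=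
  measurableSet_le measurable_snd measurable_const

lemma abs_measureReal_inter_sub_le {A B C : Set (ℝ × ℝ)} (hA : MeasurableSet A) (hAB : A ⊆ B) :
    |H.real (A ∩ C) - H.real (B ∩ C)| ≤ H.real B - H.real A := by
  have h1 : H.real (A ∩ C) ≤ H.real (B ∩ C) :=
    measureReal_mono (Set.inter_subset_inter_left _ hAB)
  have h2 : H.real (B ∩ C) ≤ H.real (A ∩ C) + H.real (B \ A) := by
    refine (measureReal_mono ?_).trans (measureReal_union_le _ _)
    intro x hx
    by_cases hxa : x ∈ A
    · exact Or.inl ⟨hxa, hx.2⟩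
    · exact Or.inr ⟨hx.1, hxa⟩
  rw [measureReal_sdiff hAB hA] at h2
  rw [abs_le]
  constructor <;> linarith

/-- Moving one argument changes a half-plane by a strip of mass `|u - u'|` or `|v - v'|`, and
intersecting with the other half-plane cannot enlarge that change. -/
lemma abs_copula_sub_le (hH : HasContinuousMarginals H) {u u' v v' : ℝ}
    (hu : u ∈ Set.Ioo (0 : ℝ) 1) (hu' : u' ∈ Set.Ioo (0 : ℝ) 1)
    (hv : v ∈ Set.Ioo (0 : ℝ) 1) (hv' : v' ∈ Set.Ioo (0 : ℝ) 1) :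
    |copula H u v - copula H u' v'| ≤ |u - u'| + |v - v'| := by
  have h1 : |copula H u v - copula H u' v| ≤ |u - u'| := by
    wlog h : u ≤ u' generalizing u u'
    · rw [abs_sub_comm, abs_sub_comm u]
      exact this hu' hu (le_of_not_ge h)
    have h2 := abs_measureReal_inter_sub_le (H := H)
      (B := {z : ℝ × ℝ | z.1 ≤ quantile H Prod.fst u'})
      (C := {z : ℝ × ℝ | z.2 ≤ quantile H Prod.snd v})
      (measurableSet_fst_le (quantile H Prod.fst u))
      (fun z (hz : z.1 ≤ _) => hz.trans (quantile_mono measurable_fst hu.1 hu'.2 h))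
    rw [abs_sub_comm u, abs_of_nonneg (sub_nonneg.2 h)]
    rwa [measureReal_fst_le_quantile hH hu, measureReal_fst_le_quantile hH hu'] at h2
  have h2 : |copula H u' v - copula H u' v'| ≤ |v - v'| := by
    clear h1
    wlog h : v ≤ v' generalizing v v'
    · rw [abs_sub_comm, abs_sub_comm v]
      exact this hv' hv (le_of_not_ge h)
    have h2 := abs_measureReal_inter_sub_le (H := H)
      (B := {z : ℝ × ℝ | z.2 ≤ quantile H Prod.snd v'})
      (C := {z : ℝ × ℝ | z.1 ≤ quantile H Prod.fst u'})
      (measurableSet_snd_le (quantile H Prod.snd v))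
      (fun z (hz : z.2 ≤ _) => hz.trans (quantile_mono measurable_snd hv.1 hv'.2 h))
    rw [abs_sub_comm v, abs_of_nonneg (sub_nonneg.2 h)]
    rw [measureReal_snd_le_quantile hH hv, measureReal_snd_le_quantile hH hv', Set.inter_comm,
      Set.inter_comm {z : ℝ × ℝ | z.2 ≤ quantile H Prod.snd v'}] at h2
    exact h2
  exact (abs_sub_le _ _ _).trans (add_le_add h1 h2)

/-- Take `u = F(x)` and `v = G(y)`. The half-plane cut at `F⁻¹(u)` lies inside the one cut at `x`
and has the same mass, so the quadrant at `(x, y)` has mass `C(u,v)`. This works where a marginal is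
flat and `F⁻¹(F(x)) < x`. -/
lemma measureReal_Iic_prod_Iic (hH : HasContinuousMarginals H)
    (hC : ∀ u ∈ Set.Ioo (0 : ℝ) 1, ∀ v ∈ Set.Ioo (0 : ℝ) 1, copula H u v = u * v) (x y : ℝ) :
    H.real (Set.Iic x ×ˢ Set.Iic y) = H.fst.real (Set.Iic x) * H.snd.real (Set.Iic y) := by
  have hx0 : H.fst.real (Set.Iic x) = H.real {z | z.1 ≤ x} := by
    rw [← cdf_fst_eq, ProbabilityTheory.cdf_eq_real]
  have hy0 : H.snd.real (Set.Iic y) = H.real {z | z.2 ≤ y} := by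
    rw [← cdf_snd_eq, ProbabilityTheory.cdf_eq_real]
  have hxy : (Set.Iic x ×ˢ Set.Iic y : Set (ℝ × ℝ)) = {z | z.1 ≤ x} ∩ {z | z.2 ≤ y} := rfl
  rw [hx0, hy0, hxy]
  set A := {z : ℝ × ℝ | z.1 ≤ x}
  set B := {z : ℝ × ℝ | z.2 ≤ y}
  have hAm : MeasurableSet A := measurableSet_fst_le x
  have hBm : MeasurableSet B := measurableSet_snd_le y
  have hA1 : H.real A ≤ 1 := measureReal_le_one
  have hB1 : H.real B ≤ 1 := measureReal_le_one
  have hA0 : 0 ≤ H.real A := measureReal_nonneg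
  have hB0 : 0 ≤ H.real B := measureReal_nonneg
  have hABA : H.real (A ∩ B) ≤ H.real A := measureReal_mono Set.inter_subset_left
  have hABB : H.real (A ∩ B) ≤ H.real B := measureReal_mono Set.inter_subset_right
  have hAB0 : 0 ≤ H.real (A ∩ B) := measureReal_nonneg
  have hu := abs_le.1 (abs_measureReal_inter_sub_le (H := H) (C := B) hAm (Set.subset_univ A))
  have hv := abs_le.1 (abs_measureReal_inter_sub_le (H := H) (C := A) hBm (Set.subset_univ B))
  rw [Set.univ_inter, probReal_univ] at hu hv
  rw [Set.inter_comm B A] at hv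
  -- Marginal masses `0` and `1` lie outside the range of `hC`; there the product formula is
  -- automatic.
  rcases hA0.eq_or_lt with h | h
  · rw [← h, zero_mul]; linarith
  rcases hA1.eq_or_lt with h' | h'
  · rw [h', one_mul]; linarith
  rcases hB0.eq_or_lt with k | k
  · rw [← k, mul_zero]; linarith
  rcases hB1.eq_or_lt with k' | k'
  · rw [k', mul_one]; linarith
  rw [← hC _ ⟨h, h'⟩ _ ⟨k, k'⟩]
  have hq1 : quantile H Prod.fst (H.real A) ≤ x :=
    csInf_le (bddBelow_quantile measurable_fst h) (le_refl (H.real A))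
  have hq2 : quantile H Prod.snd (H.real B) ≤ y :=
    csInf_le (bddBelow_quantile measurable_snd k) (le_refl (H.real B))
  set s := quantile H Prod.fst (H.real A) with hs
  set t := quantile H Prod.snd (H.real B) with ht
  have e1 := abs_measureReal_inter_sub_le (H := H) (B := A) (C := B) (measurableSet_fst_le s)
    (fun z (hz : z.1 ≤ s) => (hz.trans hq1 : z.1 ≤ x))
  have e2 := abs_measureReal_inter_sub_le (H := H) (B := B) (C := {z : ℝ × ℝ | z.1 ≤ s})
    (measurableSet_snd_le t) (fun z (hz : z.2 ≤ t) => (hz.trans hq2 : z.2 ≤ y))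
  rw [hs, measureReal_fst_le_quantile hH ⟨h, h'⟩, ← hs, sub_self] at e1
  rw [ht, measureReal_snd_le_quantile hH ⟨k, k'⟩, ← ht, sub_self, Set.inter_comm,
    Set.inter_comm B] at e2
  have e1' := sub_eq_zero.1 (abs_eq_zero.1 (le_antisymm e1 (abs_nonneg _)))
  have e2' := sub_eq_zero.1 (abs_eq_zero.1 (le_antisymm e2 (abs_nonneg _)))
  rw [← e1', ← e2']
  rfl

lemma isIndependentLaw_of_copula (hH : HasContinuousMarginals H)
    (hC : ∀ u ∈ Set.Ioo (0 : ℝ) 1, ∀ v ∈ Set.Ioo (0 : ℝ) 1, copula H u v = u * v) :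
    IsIndependentLaw H := by
  have hgen : MeasurableSpace.generateFrom (Set.range Set.Iic) = (inferInstance :
      MeasurableSpace ℝ) := by
    rw [BorelSpace.measurable_eq (α := ℝ), borel_eq_generateFrom_Iic]
  have hspan : ∀ μ : Measure ℝ, [IsProbabilityMeasure μ] →
      Nonempty (μ.FiniteSpanningSetsIn (Set.range Set.Iic)) := by
    intro μ _
    refine ⟨⟨fun n : ℕ => Set.Iic (n : ℝ), fun n => ⟨n, rfl⟩, fun n => measure_lt_top _ _, ?_⟩⟩
    exact Set.eq_univ_of_forall fun x =>
      Set.mem_iUnion.2 ((exists_nat_ge x).imp fun n hn => hn)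
  refine (Measure.prod_eq_generateFrom hgen hgen isPiSystem_Iic isPiSystem_Iic
    (hspan H.fst).some (hspan H.snd).some ?_).symm
  rintro _ ⟨x, rfl⟩ _ ⟨y, rfl⟩
  have h := measureReal_Iic_prod_Iic hH hC x y
  rw [← ENNReal.toReal_eq_toReal_iff' (measure_ne_top _ _)
    (ENNReal.mul_ne_top (measure_ne_top _ _) (measure_ne_top _ _)), ENNReal.toReal_mul]
  exact h

lemma openSquare_isOpen : IsOpen openSquare := isOpen_Ioo.prod isOpen_Ioo

lemma exists_ball_le_abs_copula_sub (hH : AlternativeLaw H) :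
    ∃ p₀ ∈ openSquare, ∃ ε > 0, ∃ a > 0, Metric.ball p₀ ε ⊆ openSquare ∧
      ∀ p ∈ Metric.ball p₀ ε, a ≤ |copula H p.1 p.2 - p.1 * p.2| := by
  have h1 := mt (isIndependentLaw_of_copula hH.1) hH.2
  push Not at h1
  obtain ⟨u, hu, v, hv, hne⟩ := h1
  have hp : (u, v) ∈ openSquare := ⟨hu, hv⟩
  obtain ⟨r, hr, hball⟩ := Metric.isOpen_iff.1 openSquare_isOpen _ hp
  set a := |copula H u v - u * v| with ha
  have ha0 : 0 < a := abs_pos.2 (sub_ne_zero.2 hne)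
  -- Within `a / 8` in each coordinate, the copula and the product `uv` each move by less than `a /
  -- 4`, leaving at least `a / 2` of the discrepancy.
  refine ⟨(u, v), hp, min r (a / 8), lt_min hr (by positivity), a / 2, by positivity,
    (Metric.ball_subset_ball (min_le_left _ _)).trans hball, fun p hpb => ?_⟩
  have hps : p ∈ openSquare := hball (Metric.ball_subset_ball (min_le_left _ _) hpb)
  have hd : dist p (u, v) < a / 8 := (Metric.mem_ball.1 hpb).trans_le (min_le_right _ _)
  rw [Prod.dist_eq, max_lt_iff, Real.dist_eq, Real.dist_eq] at hd
  have h2 := abs_copula_sub_le hH.1 hu hps.1 hv hps.2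
  rw [abs_sub_comm u, abs_sub_comm v] at h2
  have h3 : |u * v - p.1 * p.2| ≤ |p.1 - u| + |p.2 - v| := by
    have : u * v - p.1 * p.2 = -((p.1 - u) * v + p.1 * (p.2 - v)) := by ring
    rw [this, abs_neg]
    refine (abs_add_le _ _).trans (add_le_add ?_ ?_)
    · rw [abs_mul, abs_of_pos hv.1]
      exact mul_le_of_le_one_right (abs_nonneg _) hv.2.le
    · rw [abs_mul, abs_of_pos hps.1.1]
      exact mul_le_of_le_one_left (abs_nonneg _) hps.1.2.le
  have h4 : a ≤ |copula H u v - copula H p.1 p.2| + |copula H p.1 p.2 - p.1 * p.2| +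
      |u * v - p.1 * p.2| := by
    have e : copula H u v - u * v = (copula H u v - copula H p.1 p.2) +
      (copula H p.1 p.2 - p.1 * p.2) - (u * v - p.1 * p.2) := by ring
    rw [ha, e]
    exact (abs_sub _ _).trans (add_le_add (abs_add_le _ _) le_rfl)
  linarith [hd.1, hd.2]

end Copula

/-! ### Distribution freeness under independence -/

/-- The probability integral transform. -/
lemma map_cdf_eq_uniform (μ : Measure ℝ) [IsProbabilityMeasure μ]
    (hc : Continuous fun x => ProbabilityTheory.cdf μ x) :
    μ.map (fun x => ProbabilityTheory.cdf μ x) = volume.restrict (Set.Icc 0 1) := by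
  have : IsProbabilityMeasure (μ.map fun x => ProbabilityTheory.cdf μ x) :=
    Measure.isProbabilityMeasure_map hc.measurable.aemeasurable
  refine Measure.ext_of_Iic _ _ fun a => ?_
  rw [Measure.map_apply hc.measurable measurableSet_Iic,
    Measure.restrict_apply measurableSet_Iic]
  have hR : Set.Iic a ∩ Set.Icc (0 : ℝ) 1 = Set.Icc 0 (min a 1) := by
    ext x
    simp only [Set.mem_inter_iff, Set.mem_Iic, Set.mem_Icc, le_min_iff]
    tauto
  rw [hR, Real.volume_Icc, sub_zero]
  set S := (fun x => ProbabilityTheory.cdf μ x) ⁻¹' Set.Iic a with hS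
  rcases le_or_gt 1 a with ha | ha
  · have : S = Set.univ := Set.eq_univ_of_forall fun x =>
      (ProbabilityTheory.cdf_le_one μ x).trans ha
    rw [this, measure_univ, min_eq_right ha, ENNReal.ofReal_one]
  rw [min_eq_left ha.le]
  rcases S.eq_empty_or_nonempty with h | h
  · rw [h, measure_empty, eq_comm, ENNReal.ofReal_eq_zero]
    by_contra! ha0
    obtain ⟨x, hx⟩ := ((ProbabilityTheory.tendsto_cdf_atBot μ).eventually_lt_const ha0).exists
    exact (Set.eq_empty_iff_forall_notMem.1 h x) hx.le
  · have hbdd : BddAbove S := by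
      obtain ⟨b, hb⟩ := ((ProbabilityTheory.tendsto_cdf_atTop μ).eventually_const_lt ha).exists
      refine ⟨b, fun x (hx : ProbabilityTheory.cdf μ x ≤ a) => ?_⟩
      by_contra! hlt
      linarith [ProbabilityTheory.monotone_cdf μ hlt.le]
    have hmem : sSup S ∈ S := (isClosed_Iic.preimage hc).csSup_mem h hbdd
    -- The sublevel set is a closed half-line; by continuity the distribution function equals `a` at
    -- its endpoint, since otherwise the half-line would extend further.
    have hSI : S = Set.Iic (sSup S) := Set.Subset.antisymm (fun x hx => le_csSup hbdd hx)
      fun x hx => (ProbabilityTheory.monotone_cdf μ hx).trans hmem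
    rw [hSI, ← ProbabilityTheory.ofReal_cdf]
    congr 1
    refine le_antisymm hmem ?_
    by_contra! hlt
    obtain ⟨y, hy, hy'⟩ := ((hc.continuousAt.eventually_lt_const hlt).filter_mono
      nhdsWithin_le_nhds |>.and (self_mem_nhdsWithin (s := Set.Ioi (sSup S)))).exists
    exact absurd (le_csSup hbdd (show y ∈ S from hy.le)) (not_le.2 hy')

/-- `F` need not be strictly increasing: the absence of ties after the transformation already
ensures that it reverses or merges no pair. -/
lemma rank_comp_eq {x : ℕ → ℝ} {n : ℕ} {F : ℝ → ℝ} (hF : Monotone F)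
    (hx : Set.InjOn (fun i => F (x i)) (Finset.range n)) {i : ℕ} (hi : i ∈ Finset.range n) :
    rank (fun j => F (x j)) n i = rank x n i := by
  unfold rank
  congr 1
  refine Finset.filter_congr fun j hj => ⟨fun h => ?_, fun h => hF h⟩
  by_contra! hlt
  have := hx hi hj (le_antisymm (hF hlt.le) h)
  rw [this] at hlt
  exact lt_irrefl _ hlt

lemma empCopula_comp_eq {z : ℕ → ℝ × ℝ} {n : ℕ} {F G : ℝ → ℝ} (hF : Monotone F) (hG : Monotone G)
    (hx : Set.InjOn (fun i => F (z i).1) (Finset.range n))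
    (hy : Set.InjOn (fun i => G (z i).2) (Finset.range n)) (u v : ℝ) :
    empCopula (fun i => (F (z i).1, G (z i).2)) n u v = empCopula z n u v := by
  unfold empCopula
  congr 3
  refine Finset.filter_congr fun i hi => ?_
  have h1 := rank_comp_eq (x := fun j => (z j).1) hF hx hi
  have h2 := rank_comp_eq (x := fun j => (z j).2) hG hy hi
  simp only [h1, h2]

/-- The uniform law on the unit square. -/
def uniformSquare : Measure (ℝ × ℝ) :=
  (volume.restrict (Set.Icc (0 : ℝ) 1)).prod (volume.restrict (Set.Icc (0 : ℝ) 1))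

instance : IsProbabilityMeasure uniformSquare := by
  have : IsProbabilityMeasure (volume.restrict (Set.Icc (0 : ℝ) 1)) := ⟨by simp⟩
  unfold uniformSquare
  infer_instance

/-- The coordinatewise probability integral transform carries a null law to the uniform law on the
square and almost surely leaves all ranks unchanged. -/
lemma map_empCopula_eq {H : Measure (ℝ × ℝ)} [IsProbabilityMeasure H] (hH : NullLaw H)
    (n : ℕ) (u v : ℝ) :
    (iidLaw H).map (fun z => empCopula z n u v) =
      (iidLaw uniformSquare).map (fun z => empCopula z n u v) := by
  set F : ℝ → ℝ := fun x => ProbabilityTheory.cdf H.fst x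
  set G : ℝ → ℝ := fun x => ProbabilityTheory.cdf H.snd x
  have hFm : Measurable F := hH.1.1.measurable
  have hGm : Measurable G := hH.1.2.measurable
  have hFU := map_cdf_eq_uniform H.fst hH.1.1
  have hGU := map_cdf_eq_uniform H.snd hH.1.2
  have h1 : H.map (Prod.map F G) = uniformSquare := by
    conv_lhs => rw [hH.2]
    rw [← Measure.map_prod_map _ _ hFm hGm, hFU, hGU]
    rfl
  have hprob : ∀ i : ℕ, IsProbabilityMeasure (H.map (Prod.map F G)) := fun _ =>
    Measure.isProbabilityMeasure_map (hFm.prodMap hGm).aemeasurable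
  have h2 : (iidLaw H).map (fun z i => Prod.map F G (z i)) = iidLaw uniformSquare := by
    unfold iidLaw
    rw [Measure.infinitePi_map_pi (fun _ : ℕ => H) (f := fun _ => Prod.map F G)
      (fun _ => hFm.prodMap hGm)]
    congr 1
    funext
    exact h1
  have hΦ : Measurable fun (z : ℕ → ℝ × ℝ) (i : ℕ) => Prod.map F G (z i) :=
    measurable_pi_lambda _ fun i => (hFm.prodMap hGm).comp (measurable_pi_apply i)
  rw [← h2, Measure.map_map (measurable_empCopula n u v) hΦ]
  have : NullSingletonClass (H.map fun w => F w.1) := by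
    have : (H.map fun w => F w.1) = H.fst.map F := by
      rw [Measure.fst, Measure.map_map hFm measurable_fst]; rfl
    rw [this, hFU]
    infer_instance
  have : NullSingletonClass (H.map fun w => G w.2) := by
    have : (H.map fun w => G w.2) = H.snd.map G := by
      rw [Measure.snd, Measure.map_map hGm measurable_snd]; rfl
    rw [this, hGU]
    infer_instance
  refine Measure.map_congr ?_
  filter_upwards [ae_injOn (H := H) (g := fun w => F w.1) (by fun_prop) n,
    ae_injOn (H := H) (g := fun w => G w.2) (by fun_prop) n] with z hx hy
  exact (empCopula_comp_eq (ProbabilityTheory.monotone_cdf _) (ProbabilityTheory.monotone_cdf _)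
    hx hy u v).symm

lemma measureReal_empCopula_eq {H H' : Measure (ℝ × ℝ)} [IsProbabilityMeasure H]
    [IsProbabilityMeasure H'] (hH : NullLaw H) (hH' : NullLaw H') (n : ℕ) (u v : ℝ) {S : Set ℝ}
    (hS : MeasurableSet S) :
    (iidLaw H).real {z | empCopula z n u v ∈ S} = (iidLaw H').real {z | empCopula z n u v ∈ S} := by
  have h := congrArg (fun μ : Measure ℝ => μ.real S)
    ((map_empCopula_eq hH n u v).trans (map_empCopula_eq hH' n u v).symm)
  simp only [map_measureReal_apply (measurable_empCopula n u v) hS] at h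
  exact h

/-! ### The overall level -/

lemma empCopula_eq_of_floor (z : ℕ → ℝ × ℝ) {n : ℕ} (hn : 1 ≤ n) {u u' v v' : ℝ} (hu : 0 ≤ u)
    (hu' : 0 ≤ u') (hv : 0 ≤ v) (hv' : 0 ≤ v') (h1 : ⌊n * u⌋₊ = ⌊n * u'⌋₊)
    (h2 : ⌊n * v⌋₊ = ⌊n * v'⌋₊) : empCopula z n u v = empCopula z n u' v' := by
  simp only [empCopula, rank_div_le_iff hn hu, rank_div_le_iff hn hu', rank_div_le_iff hn hv,
    rank_div_le_iff hn hv', h1, h2]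

lemma finite_range_empCopula (n : ℕ) (u v : ℝ) :
    (Set.range fun z => empCopula z n u v).Finite := by
  refine ((Set.finite_Iic n).image fun k : ℕ => (k : ℝ) / n).subset ?_
  rintro _ ⟨z, rfl⟩
  exact ⟨_, (Finset.card_filter_le _ _).trans (Finset.card_range n).le, rfl⟩

lemma sqrt_pos_of_mem {u v : ℝ} (hu : u ∈ Set.Ioo (0 : ℝ) 1) (hv : v ∈ Set.Ioo (0 : ℝ) 1) :
    0 < Real.sqrt (u * v * (1 - u) * (1 - v)) := by
  have h1 := sub_pos.2 hu.2
  have h2 := sub_pos.2 hv.2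
  have h3 := hu.1
  have h4 := hv.1
  positivity

lemma qn_le_qn_iff {u v : ℝ} (hu : u ∈ Set.Ioo (0 : ℝ) 1) (hv : v ∈ Set.Ioo (0 : ℝ) 1)
    (z z' : ℕ → ℝ × ℝ) (n : ℕ) :
    qn z n u v ≤ qn z' n u v ↔ empCopula z n u v ≤ empCopula z' n u v := by
  unfold qn
  rw [div_le_div_iff_of_pos_right (sqrt_pos_of_mem hu hv), sub_le_sub_iff_right]

/-- The samples whose empirical copula at `(u,v)` lies in one of the tails of mass `η / 2` of its
law under `H`. -/
def tailRegion (H : Measure (ℝ × ℝ)) [IsProbabilityMeasure H] (n : ℕ) (η u v : ℝ) :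
    Set (ℕ → ℝ × ℝ) :=
  {z | (iidLaw H).real {z' | empCopula z' n u v ≤ empCopula z n u v} ≤ η / 2} ∪
    {z | (iidLaw H).real {z' | empCopula z n u v ≤ empCopula z' n u v} ≤ η / 2}

/-- The region is described by tail probabilities of `C_n(u,v)` alone, so distribution freeness
makes it the same set for all null laws. -/
lemma tailRegion_eq {H H' : Measure (ℝ × ℝ)} [IsProbabilityMeasure H]
    [IsProbabilityMeasure H'] (hH : NullLaw H) (hH' : NullLaw H') (n : ℕ) (η u v : ℝ) :
    tailRegion H n η u v = tailRegion H' n η u v := by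
  have h1 : ∀ a : ℝ, (iidLaw H).real {z' | empCopula z' n u v ≤ a} =
      (iidLaw H').real {z' | empCopula z' n u v ≤ a} := fun a =>
    measureReal_empCopula_eq hH hH' n u v measurableSet_Iic
  have h2 : ∀ a : ℝ, (iidLaw H).real {z' | a ≤ empCopula z' n u v} =
      (iidLaw H').real {z' | a ≤ empCopula z' n u v} := fun a =>
    measureReal_empCopula_eq hH hH' n u v measurableSet_Ici
  simp only [tailRegion, h1, h2]

lemma measureReal_tailRegion_le (H : Measure (ℝ × ℝ)) [IsProbabilityMeasure H] (n : ℕ) {η : ℝ}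
    (hη : 0 ≤ η) (u v : ℝ) : (iidLaw H).real (tailRegion H n η u v) ≤ η := by
  have h1 := measureReal_tail_le (P := iidLaw H) (finite_range_empCopula n u v)
    (show 0 ≤ η / 2 by positivity)
  have hfin : (Set.range fun z => -empCopula z n u v).Finite := by
    have := (finite_range_empCopula n u v).image Neg.neg
    rwa [← Set.range_comp] at this
  have h2 := measureReal_tail_le (P := iidLaw H) hfin (show 0 ≤ η / 2 by positivity)
  simp only [neg_le_neg_iff] at h2
  refine (measureReal_union_le _ _).trans ((add_le_add h1 h2).trans (by linarith))

/-- At a fixed point of the open square `q_n` is an increasing affine function of `C_n`, so crossing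
a quantile of `q_n` puts `C_n` in a tail of its own law. -/
lemma mem_tailRegion {H : Measure (ℝ × ℝ)} [IsProbabilityMeasure H] {n : ℕ} {η : ℝ}
    (hη : 0 < η) {u v : ℝ} (hu : u ∈ Set.Ioo (0 : ℝ) 1) (hv : v ∈ Set.Ioo (0 : ℝ) 1)
    {z : ℕ → ℝ × ℝ}
    (h : qn z n u v < lowerSurface H n η u v ∨ upperSurface H n η u v < qn z n u v) :
    z ∈ tailRegion H n η u v := by
  have hm := measurable_qn n u v
  rcases h with h | h
  · refine Or.inl ?_
    simp only [Set.mem_ofPred_eq, ← qn_le_qn_iff hu hv]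
    by_contra! hlt
    have hmem : qn z n u v ∈ {x | η / 2 ≤ (iidLaw H).real {z' | qn z' n u v ≤ x}} := hlt.le
    exact absurd (csInf_le (bddBelow_quantile hm (by positivity)) hmem) (not_le.2 h)
  · refine Or.inr ?_
    simp only [Set.mem_ofPred_eq, ← qn_le_qn_iff hu hv]
    -- Lying strictly above the infimum leaves room for a level `x` that already carries mass `1 - η
    -- / 2` strictly below the observed value.
    obtain ⟨x, hx, hxz⟩ := exists_lt_of_csInf_lt
      (nonempty_quantile (P := iidLaw H) hm (show 1 - η / 2 < 1 by linarith)) h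
    have h1 : {z' | qn z n u v ≤ qn z' n u v} ⊆ {z' | qn z' n u v ≤ x}ᶜ := fun z' hz' => by
      simp only [Set.mem_ofPred_eq, Set.mem_compl_iff, not_le] at hz' ⊢
      exact hxz.trans_le hz'
    have h2 := measureReal_mono (μ := iidLaw H) h1
    rw [probReal_compl_eq_one_sub (measurableSet_le hm measurable_const)] at h2
    have h3 : 1 - η / 2 ≤ (iidLaw H).real {z' | qn z' n u v ≤ x} := hx
    linarith

/-- Uncountably many test points collapse to `n ^ 2` cells, each represented by its lower corner.
Index `0` is needed for the cells touching the axes; the corner is then outside the open square,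
which is harmless because `tailRegion` uses `C_n` and not the normalised `q_n`. -/
lemma rejectionRegion_subset {H : Measure (ℝ × ℝ)} [IsProbabilityMeasure H] {n : ℕ} (hn : 1 ≤ n)
    {η : ℝ} (hη : 0 < η) :
    rejectionRegion H n η openSquare ⊆
      ⋃ k ∈ Finset.range n ×ˢ Finset.range n, tailRegion H n η (k.1 / n) (k.2 / n) := by
  rintro z ⟨⟨u, v⟩, ⟨hu, hv⟩, h⟩
  have hn' : (0 : ℝ) < n := by exact_mod_cast hn
  have h1 := mem_tailRegion hη hu hv h
  have hlt : ∀ {w : ℝ}, w ∈ Set.Ioo (0 : ℝ) 1 → ⌊n * w⌋₊ < n := fun {w} hw =>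
    (Nat.floor_lt (mul_nonneg hn'.le hw.1.le)).2 (by nlinarith [hw.2])
  have hfl : ∀ w : ℝ, ⌊n * w⌋₊ = ⌊n * ((⌊n * w⌋₊ : ℝ) / n)⌋₊ := fun w => by
    rw [mul_div_cancel₀ _ hn'.ne', Nat.floor_natCast]
  refine Set.mem_iUnion₂.2 ⟨(⌊n * u⌋₊, ⌊n * v⌋₊), ?_, ?_⟩
  · exact Finset.mem_product.2 ⟨Finset.mem_range.2 (hlt hu), Finset.mem_range.2 (hlt hv)⟩
  · have he : ∀ z' : ℕ → ℝ × ℝ, empCopula z' n ((⌊n * u⌋₊ : ℝ) / n) ((⌊n * v⌋₊ : ℝ) / n) =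
        empCopula z' n u v := fun z' =>
      (empCopula_eq_of_floor z' hn hu.1.le (by positivity) hv.1.le (by positivity)
        (hfl u) (hfl v)).symm
    simp only [tailRegion, he]
    exact h1

lemma measureReal_rejectionRegion_le {H H' : Measure (ℝ × ℝ)} [IsProbabilityMeasure H]
    [IsProbabilityMeasure H'] (hH : NullLaw H) (hH' : NullLaw H') {n : ℕ} (hn : 1 ≤ n) {α : ℝ}
    (hα : 0 < α) :
    (iidLaw H').real (rejectionRegion H n (α / (n : ℝ) ^ 2) openSquare) ≤ α := by
  have hn' : (0 : ℝ) < n := by exact_mod_cast hn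
  have hη : 0 < α / (n : ℝ) ^ 2 := by positivity
  refine (measureReal_mono (rejectionRegion_subset hn hη) (measure_ne_top _ _)).trans ?_
  refine (measureReal_biUnion_finset_le _ _).trans ?_
  refine (Finset.sum_le_card_nsmul _ _ (α / (n : ℝ) ^ 2) fun k _ => ?_).trans ?_
  · rw [tailRegion_eq hH hH']
    exact measureReal_tailRegion_le H' n hη.le _ _
  · rw [Finset.card_product, Finset.card_range, nsmul_eq_mul]
    push_cast
    field_simp
    rfl

/-! ### The critical surfaces -/

lemma eventually_abs_surface_le {H : Measure (ℝ × ℝ)} [IsProbabilityMeasure H] (hH : NullLaw H)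
    {α ε : ℝ} (hα : 0 < α) (hε : 0 < ε) : ∀ᶠ n : ℕ in atTop, ∀ η : ℝ, α / (n : ℝ) ^ 2 ≤ η → η ≤ 1 →
      ∀ u ∈ Set.Ioo (0 : ℝ) 1, ∀ v ∈ Set.Ioo (0 : ℝ) 1,
        |lowerSurface H n η u v| ≤ ε / Real.sqrt (u * v * (1 - u) * (1 - v)) ∧
        |upperSurface H n η u v| ≤ ε / Real.sqrt (u * v * (1 - u) * (1 - v)) := by
  -- The surfaces are quantiles of orders `η / 2` and `1 - η / 2`, so the tail must be below `α /
  -- (2n²) ≤ η / 2`; as `η ≤ 1`, it is then also below `1 - η / 2`.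
  filter_upwards [eventually_measureReal_empCopula_lt hH.1 hε (half_pos hα)]
    with n hn η hη hη1 u hu v hv
  have h1 := hn u hu v hv
  rw [copula_of_null hH hu hv] at h1
  have hs := sqrt_pos_of_mem hu hv
  have h2 : (iidLaw H).real {z | ε / Real.sqrt (u * v * (1 - u) * (1 - v)) < |qn z n u v|}
      < η / 2 := by
    have h3 : α / 2 / (n : ℝ) ^ 2 = α / (n : ℝ) ^ 2 / 2 := by ring
    simp only [qn, abs_div, abs_of_pos hs, div_lt_div_iff_of_pos_right hs]
    linarith
  have hm := measurable_qn n u v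
  exact ⟨abs_quantile_le hm h2 (by linarith), abs_quantile_le hm (by linarith) (by linarith)⟩

lemma tendsto_quantile_empCopula {H : Measure (ℝ × ℝ)} [IsProbabilityMeasure H] (hH : NullLaw H)
    {α : ℝ} (hα0 : 0 < α) (hα1 : α < 1) {u v : ℝ} (hu : u ∈ Set.Ioo (0 : ℝ) 1)
    (hv : v ∈ Set.Ioo (0 : ℝ) 1) :
    Tendsto (fun n : ℕ =>
      quantile (iidLaw H) (fun z => empCopula z n u v - u * v) (α / (n : ℝ) ^ 2)) atTop (𝓝 0) ∧
    Tendsto (fun n : ℕ =>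
      quantile (iidLaw H) (fun z => empCopula z n u v - u * v) (1 - α / (n : ℝ) ^ 2))
        atTop (𝓝 0) := by
  have key : ∀ ε > 0, ∀ᶠ n : ℕ in atTop,
      |quantile (iidLaw H) (fun z => empCopula z n u v - u * v) (α / (n : ℝ) ^ 2)| < ε ∧
      |quantile (iidLaw H) (fun z => empCopula z n u v - u * v) (1 - α / (n : ℝ) ^ 2)| < ε := by
    intro ε hε
    filter_upwards [eventually_measureReal_empCopula_lt hH.1 (half_pos hε) (half_pos hα0),
      eventually_ge_atTop 2] with n hn hn2
    have h1 := hn u hu v hv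
    rw [copula_of_null hH hu hv] at h1
    have h2 : (2 : ℝ) ≤ n := by exact_mod_cast hn2
    -- Taking `n ≥ 2` keeps `1 - α / n ^ 2` well above the tail bound `α / (2n²)`.
    have h3 : α / (n : ℝ) ^ 2 ≤ 1 / 4 := by
      rw [div_le_iff₀ (by positivity)]
      nlinarith
    have h4 : 0 ≤ α / (n : ℝ) ^ 2 := by positivity
    have h5 : α / 2 / (n : ℝ) ^ 2 = α / (n : ℝ) ^ 2 / 2 := by ring
    have hm : Measurable fun z => empCopula z n u v - u * v :=
      (measurable_empCopula n u v).sub_const _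
    exact ⟨(abs_quantile_le hm (by linarith) (by linarith)).trans_lt (half_lt_self hε),
      (abs_quantile_le hm (by linarith) (by linarith)).trans_lt (half_lt_self hε)⟩
  constructor <;>
  · refine Metric.tendsto_nhds.2 fun ε hε => ?_
    filter_upwards [key ε hε] with n hn
    rw [Real.dist_0_eq_abs]
    first | exact hn.1 | exact hn.2

lemma tendsto_surface {H : Measure (ℝ × ℝ)} [IsProbabilityMeasure H] (hH : NullLaw H)
    {α : ℝ} (hα : 0 < α) {η : ℕ → ℝ} (hη : ∀ᶠ n : ℕ in atTop, α / (n : ℝ) ^ 2 ≤ η n ∧ η n ≤ 1)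
    {u v : ℝ} (hu : u ∈ Set.Ioo (0 : ℝ) 1) (hv : v ∈ Set.Ioo (0 : ℝ) 1) :
    Tendsto (fun n : ℕ => lowerSurface H n (η n) u v) atTop (𝓝 0) ∧
      Tendsto (fun n : ℕ => upperSurface H n (η n) u v) atTop (𝓝 0) := by
  have hs := sqrt_pos_of_mem hu hv
  have key : ∀ ε > 0, ∀ᶠ n : ℕ in atTop,
      |lowerSurface H n (η n) u v| < ε ∧ |upperSurface H n (η n) u v| < ε := by
    intro ε hε
    filter_upwards [eventually_abs_surface_le hH hα (mul_pos (half_pos hε) hs), hη] with n hn hηn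
    have h1 := hn (η n) hηn.1 hηn.2 u hu v hv
    rw [mul_div_cancel_right₀ _ hs.ne'] at h1
    exact ⟨h1.1.trans_lt (half_lt_self hε), h1.2.trans_lt (half_lt_self hε)⟩
  constructor <;>
  · refine Metric.tendsto_nhds.2 fun ε hε => ?_
    filter_upwards [key ε hε] with n hn
    rw [Real.dist_0_eq_abs]
    first | exact hn.1 | exact hn.2

/-! ### Behaviour under alternatives -/

lemma tendstoInMeasure_empCopula {H : Measure (ℝ × ℝ)} [IsProbabilityMeasure H]
    (hH : HasContinuousMarginals H) {u v : ℝ} (hu : u ∈ Set.Ioo (0 : ℝ) 1)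
    (hv : v ∈ Set.Ioo (0 : ℝ) 1) :
    TendstoInMeasure (iidLaw H) (fun (n : ℕ) z => empCopula z n u v - u * v) atTop
      (fun _ => copula H u v - u * v) := by
  rw [tendstoInMeasure_iff_measureReal_norm]
  intro ε hε
  have hlim : Tendsto (fun n : ℕ => 1 / (n : ℝ) ^ 2) atTop (𝓝 0) :=
    tendsto_const_nhds.div_atTop ((tendsto_pow_atTop two_ne_zero).comp
      tendsto_natCast_atTop_atTop)
  refine tendsto_of_tendsto_of_tendsto_of_le_of_le' tendsto_const_nhds hlim
    (Eventually.of_forall fun n => measureReal_nonneg) ?_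
  filter_upwards [eventually_measureReal_empCopula_lt hH (half_pos hε) one_pos] with n hn
  refine (measureReal_mono fun z hz => ?_).trans (hn u hu v hv).le
  simp only [Set.mem_ofPred_eq, sub_sub_sub_cancel_right, Real.norm_eq_abs] at hz ⊢
  linarith

lemma tendsto_measureReal_rejectionRegion {H₀ H : Measure (ℝ × ℝ)} [IsProbabilityMeasure H₀]
    [IsProbabilityMeasure H] (hH₀ : NullLaw H₀) (hH : AlternativeLaw H) {α : ℝ} (hα : 0 < α)
    {η : ℕ → ℝ} (hη : ∀ᶠ n : ℕ in atTop, α / (n : ℝ) ^ 2 ≤ η n ∧ η n ≤ 1)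
    {T : ℕ → Set (ℝ × ℝ)} (hT : RefiningTestPoints T) :
    Tendsto (fun n : ℕ => (iidLaw H).real (rejectionRegion H₀ n (η n) (T n))) atTop (𝓝 1) := by
  obtain ⟨p₀, hp₀, ε, hε, a, ha, hball, hsep⟩ := exists_ball_le_abs_copula_sub hH
  have hlim : Tendsto (fun n : ℕ => 1 - 1 / (n : ℝ) ^ 2) atTop (𝓝 1) := by
    have : Tendsto (fun n : ℕ => 1 / (n : ℝ) ^ 2) atTop (𝓝 0) :=
      tendsto_const_nhds.div_atTop ((tendsto_pow_atTop two_ne_zero).comp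
        tendsto_natCast_atTop_atTop)
    simpa using this.const_sub 1
  refine tendsto_of_tendsto_of_tendsto_of_le_of_le' hlim tendsto_const_nhds ?_
    (Eventually.of_forall fun n => measureReal_le_one)
  -- A deviation of at most `a / 4` leaves `|C_n - uv| ≥ 3a / 4`, which exceeds the surface bound `a
  -- / 4`; both sides carry the same normalising square root.
  have ha4 : 0 < a / 4 := by positivity
  filter_upwards [hη, hT.2 p₀ hp₀ ε hε, eventually_abs_surface_le hH₀ hα ha4,
    eventually_measureReal_empCopula_lt hH.1 ha4 one_pos] with n hηn hTn hsurf hconc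
  obtain ⟨p, hpT, hpb⟩ := hTn
  obtain ⟨hu, hv⟩ := hball hpb
  have hs := sqrt_pos_of_mem hu hv
  have h1 := hsurf (η n) hηn.1 hηn.2 p.1 hu p.2 hv
  have h2 := hconc p.1 hu p.2 hv
  have h3 : {z | a / 4 < |empCopula z n p.1 p.2 - copula H p.1 p.2|}ᶜ ⊆
      rejectionRegion H₀ n (η n) (T n) := by
    intro z hz
    simp only [Set.mem_compl_iff, Set.mem_ofPred_eq, not_lt] at hz
    refine ⟨p, hpT, ?_⟩
    have h4 := hsep p hpb
    have h5 := abs_sub_le (copula H p.1 p.2) (empCopula z n p.1 p.2) (p.1 * p.2)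
    rw [abs_sub_comm (copula H p.1 p.2) (empCopula z n p.1 p.2)] at h5
    have h6 : a / 4 / Real.sqrt (p.1 * p.2 * (1 - p.1) * (1 - p.2)) < |qn z n p.1 p.2| := by
      rw [qn, abs_div, abs_of_pos hs, div_lt_div_iff_of_pos_right hs]
      linarith
    rcases lt_abs.1 h6 with h7 | h7
    · exact Or.inr ((le_abs_self _).trans h1.2 |>.trans_lt h7)
    · exact Or.inl (by linarith [neg_abs_le (lowerSurface H₀ n (η n) p.1 p.2), h1.1])
  have h4 := measureReal_mono (μ := iidLaw H) h3
  have hm : Measurable fun z => |empCopula z n p.1 p.2 - copula H p.1 p.2| :=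
    ((measurable_empCopula n p.1 p.2).sub_const _).norm
  rw [probReal_compl_eq_one_sub (measurableSet_lt measurable_const hm)] at h4
  linarith

lemma le_localLevel {H : Measure (ℝ × ℝ)} [IsProbabilityMeasure H] (hH : NullLaw H) {n : ℕ}
    (hn : 1 ≤ n) {α : ℝ} (hα0 : 0 < α) (hα1 : α < 1) :
    α / (n : ℝ) ^ 2 ≤ localLevel H n α ∧ localLevel H n α ≤ 1 := by
  have hn' : (1 : ℝ) ≤ n := by exact_mod_cast hn
  have hmem : α / (n : ℝ) ^ 2 ∈ {η : ℝ | 0 < η ∧ η ≤ 1 ∧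
      (iidLaw H).real (rejectionRegion H n η openSquare) ≤ α} := by
    refine ⟨by positivity, ?_, measureReal_rejectionRegion_le hH hH hn hα0⟩
    rw [div_le_one (by positivity)]
    nlinarith
  exact ⟨le_csSup ⟨1, fun η hη => hη.2.1⟩ hmem, csSup_le ⟨_, hmem⟩ fun η hη => hη.2.1⟩

end CriticalSurface

end

open CriticalSurface in
theorem mainTheorem3 (α : ℝ) (hα0 : 0 < α) (hα1 : α < 1)
    (H₀ : Measure (ℝ × ℝ)) [IsProbabilityMeasure H₀] (hH₀ : NullLaw H₀) :
    -- local quantiles of `C_n(u,v) - uv` under independence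
    (∀ u ∈ Set.Ioo (0 : ℝ) 1, ∀ v ∈ Set.Ioo (0 : ℝ) 1,
      Tendsto (fun n : ℕ =>
        quantile (iidLaw H₀) (fun z => empCopula z n u v - u * v) (α / (n : ℝ) ^ 2))
        atTop (𝓝 0) ∧
      Tendsto (fun n : ℕ =>
        quantile (iidLaw H₀) (fun z => empCopula z n u v - u * v) (1 - α / (n : ℝ) ^ 2))
        atTop (𝓝 0)) ∧
    -- both critical surfaces tend to zero, for all admissible local levels
    (∀ η : ℕ → ℝ, (∀ᶠ n : ℕ in atTop, α / (n : ℝ) ^ 2 ≤ η n ∧ η n ≤ 1) →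
      ∀ u ∈ Set.Ioo (0 : ℝ) 1, ∀ v ∈ Set.Ioo (0 : ℝ) 1,
        Tendsto (fun n : ℕ => lowerSurface H₀ n (η n) u v) atTop (𝓝 0) ∧
        Tendsto (fun n : ℕ => upperSurface H₀ n (η n) u v) atTop (𝓝 0)) ∧
    -- the local level `α / n ^ 2` keeps the overall level `α`, whatever the null law of the data
    (∀ (H₁ : Measure (ℝ × ℝ)) [IsProbabilityMeasure H₁], NullLaw H₁ → ∀ n : ℕ, 1 ≤ n →
      (iidLaw H₁).real (rejectionRegion H₀ n (α / (n : ℝ) ^ 2) openSquare) ≤ α) ∧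
    -- the calibrated local level is admissible
    (∀ n : ℕ, 1 ≤ n → α / (n : ℝ) ^ 2 ≤ localLevel H₀ n α ∧ localLevel H₀ n α ≤ 1) ∧
    -- behaviour under any fixed alternative
    (∀ (H : Measure (ℝ × ℝ)) [IsProbabilityMeasure H], AlternativeLaw H →
      (∀ u ∈ Set.Ioo (0 : ℝ) 1, ∀ v ∈ Set.Ioo (0 : ℝ) 1,
        TendstoInMeasure (iidLaw H) (fun (n : ℕ) z => empCopula z n u v - u * v) atTop
          (fun _ => copula H u v - u * v)) ∧
      (∃ p₀ ∈ openSquare, ∃ ε > 0, ∃ a > 0, Metric.ball p₀ ε ⊆ openSquare ∧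
        ∀ p ∈ Metric.ball p₀ ε, a ≤ |copula H p.1 p.2 - p.1 * p.2|) ∧
      -- the power of the test tends to one
      (∀ η : ℕ → ℝ, (∀ᶠ n : ℕ in atTop, α / (n : ℝ) ^ 2 ≤ η n ∧ η n ≤ 1) →
        ∀ T : ℕ → Set (ℝ × ℝ), RefiningTestPoints T →
          Tendsto (fun n : ℕ => (iidLaw H).real (rejectionRegion H₀ n (η n) (T n)))
            atTop (𝓝 1))) := by
  refine ⟨fun u hu v hv => tendsto_quantile_empCopula hH₀ hα0 hα1 hu hv,
    fun η hη u hu v hv => tendsto_surface hH₀ hα0 hη hu hv,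
    fun H₁ _ hH₁ n hn => measureReal_rejectionRegion_le hH₀ hH₁ hn hα0,
    fun n hn => le_localLevel hH₀ hn hα0 hα1,
    fun H _ hH => ⟨fun u hu v hv => tendstoInMeasure_empCopula hH.1 hu hv,
      exists_ball_le_abs_copula_sub hH,
      fun η hη T hT => tendsto_measureReal_rejectionRegion hH₀ hH hα0 hη hT⟩⟩
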